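/- An edge-ordered graph is a finite simple graph together with a total order on its edge set. An embedding of an edge-ordered graph $F$ into an edge-ordered graph $H$ is an injective map $V(F)\to V(H)$ that sends edges to edges and preserves the order of the edges; if one exists, $H$ contains a copy of $F$. A perfect $F$-tiling in $H$ is a collection of vertex-disjoint copies of $F$ in $H$ that covers all vertices of $H$. An edge-ordered graph $F$ on $f$ vertices is tileable if there is a positive integer $t$ divisible by $f$ such that every edge-ordering of the complete graph $K_t$ contains a perfect $F$-tiling. In the min ordering of $K_n$ on $v_1,\dots,v_n$ the edges $v_iv_j$ $(i<j)$ are ordered first by $i$ and then by $j$; in the max ordering they are ordered first by $j$ and then by $i$. A vertex $v$ of an edge-ordered graph $F$ on $n$ vertices is minimal (maximal) if some embedding of $F$ into the min (max) ordering of $K_n$ sends $v$ to $v_1$ (to $v_n$). Let $K_4^-$ be $K_4$ with one edge removed, and let $D_4$ be the edge-ordering $u_1u_2<u_1u_3<u_1u_4<u_2u_4<u_3u_4$ of $K_4^-$. For every $n\ge 6$ there is a connected $n$-vertex tileable edge-ordered graph $F_n$ whose underlying graph contains $K_4^-$. More precisely, there are edge-ordered graphs $F_n$ on $n$ vertices $(n\ge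 4)$ such that: 1. $F_4=D_4$; 2. for every even $n\ge 4$, $F_{n+1}$ arises from $F_n$ by adding a new vertex and joining it to a minimal vertex of $F_n$ by an edge smaller than all edges of $F_n$; 3. for every odd $n\ge 5$, $F_{n+1}$ arises from $F_n$ by adding a new vertex and joining it to a maximal vertex of $F_n$ by an edge larger than all edges of $F_n$; 4. for every $n\ge 6$, $F_n$ is connected and tileable, its underlying graph contains $K_4^-$, and $F_n$ contains a copy of $D_4$. The connected edge-ordered graph $D_4$ is itself not tileable. Consequently tileability is not closed under taking connected subgraphs: there are connected edge-ordered graphs $A$ and $B$ such that $B$ is tileable and contains a copy of $A$, but $A$ is not tileable. -/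

import Mathlib

/-- An edge-ordered graph on the vertex set `V`: a simple graph together with a strict total
order `lt` on its edge set.  (`lt` is a relation on unordered pairs which only relates edges of
the graph, so that it carries no information beyond the order of the edges.) -/
structure EdgeOrderedGraph (V : Type*) where
  graph : SimpleGraph V
  lt : Sym2 V → Sym2 V → Prop
  mem_of_lt : ∀ e e', lt e e' → e ∈ graph.edgeSet ∧ e' ∈ graph.edgeSet
  irrefl : ∀ e, ¬ lt e e
  trans : ∀ e₁ e₂ e₃, lt e₁ e₂ → lt e₂ e₃ → lt e₁ e₃
  total : ∀ e ∈ graph.edgeSet, ∀ e' ∈ graph.edgeSet, e ≠ e' → lt e e' ∨ lt e' e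

namespace EdgeOrderedGraph

/-- The edge-ordering of the graph `G` induced by an injective labeling `L` of its edges. -/
def ofLabeling {V α : Type*} [LinearOrder α] (G : SimpleGraph V) (L : Sym2 V → α)
    (hL : Set.InjOn L G.edgeSet) : EdgeOrderedGraph V where
  graph := G
  lt e e' := e ∈ G.edgeSet ∧ e' ∈ G.edgeSet ∧ L e < L e'
  mem_of_lt _ _ h := ⟨h.1, h.2.1⟩
  irrefl _ h := lt_irrefl _ h.2.2
  trans _ _ _ h h' := ⟨h.1, h'.2.1, lt_trans h.2.2 h'.2.2⟩
  total e he e' he' hne := by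
    rcases lt_trichotomy (L e) (L e') with h | h | h
    · exact Or.inl ⟨he, he', h⟩
    · exact absurd (hL he he' h) hne
    · exact Or.inr ⟨he', he, h⟩

/-- `φ` is an embedding of `F` into `H`: it is injective, maps edges to edges and preserves the
order of the edges. -/
structure IsEmbedding {V W : Type*} (F : EdgeOrderedGraph V) (H : EdgeOrderedGraph W)
    (φ : V → W) : Prop where
  injective : Function.Injective φ
  map_adj : ∀ u v, F.graph.Adj u v → H.graph.Adj (φ u) (φ v)
  map_lt : ∀ e e', F.lt e e' → H.lt (e.map φ) (e'.map φ)

/-- `H` contains a copy of `F`, i.e. `F` is (isomorphic to) an edge-ordered subgraph of `H`. -/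
def ContainsCopy {V W : Type*} (H : EdgeOrderedGraph W) (F : EdgeOrderedGraph V) : Prop :=
  ∃ φ : V → W, IsEmbedding F H φ

/-- `H` contains a perfect `F`-tiling: a collection of vertex-disjoint copies of `F` in `H`
covering all the vertices of `H`. -/
def HasPerfectTiling {V W : Type*} (H : EdgeOrderedGraph W) (F : EdgeOrderedGraph V) : Prop :=
  ∃ T : Set (V → W), (∀ φ ∈ T, IsEmbedding F H φ) ∧
    T.PairwiseDisjoint (fun φ => Set.range φ) ∧ (⋃ φ ∈ T, Set.range φ) = Set.univ

/-- `F` is tileable: for some positive `t` divisible by the number of vertices of `F`, every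
edge-ordering of the complete graph on `t` vertices contains a perfect `F`-tiling. -/
def Tileable {V : Type*} [Fintype V] (F : EdgeOrderedGraph V) : Prop :=
  ∃ t : ℕ, 0 < t ∧ Fintype.card V ∣ t ∧
    ∀ H : EdgeOrderedGraph (Fin t), H.graph = ⊤ → H.HasPerfectTiling F

/-- The min ordering of the complete graph on `v₁, …, vₙ`: edges `vᵢvⱼ` with `i < j` are compared
first by `i` and then by `j`. -/
def minOrdering (n : ℕ) : EdgeOrderedGraph (Fin n) :=
  ofLabeling (⊤ : SimpleGraph (Fin n)) (fun e => toLex (e.inf, e.sup)) (by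
    intro e _ e' _ h
    have h' : (e.inf, e.sup) = (e'.inf, e'.sup) := toLex.injective h
    exact Sym2.inf_eq_inf_and_sup_eq_sup.mp ⟨(Prod.mk.inj h').1, (Prod.mk.inj h').2⟩)

/-- The max ordering of the complete graph on `v₁, …, vₙ`: edges `vᵢvⱼ` with `i < j` are compared
first by `j` and then by `i`. -/
def maxOrdering (n : ℕ) : EdgeOrderedGraph (Fin n) :=
  ofLabeling (⊤ : SimpleGraph (Fin n)) (fun e => toLex (e.sup, e.inf)) (by
    intro e _ e' _ h
    have h' : (e.sup, e.inf) = (e'.sup, e'.inf) := toLex.injective h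
    exact Sym2.inf_eq_inf_and_sup_eq_sup.mp ⟨(Prod.mk.inj h').2, (Prod.mk.inj h').1⟩)

/-- `v` is minimal in `F`: it plays the role of the first vertex in some embedding of `F` into the
min ordering of the complete graph on as many vertices as `F`. -/
def IsMinimalVertex {n : ℕ} (F : EdgeOrderedGraph (Fin n)) (v : Fin n) : Prop :=
  ∃ φ : Fin n → Fin n, IsEmbedding F (minOrdering n) φ ∧ (φ v : ℕ) = 0

/-- `v` is maximal in `F`: it plays the role of the last vertex in some embedding of `F` into the
max ordering of the complete graph on as many vertices as `F`. -/
def IsMaximalVertex {n : ℕ} (F : EdgeOrderedGraph (Fin n)) (v : Fin n) : Prop :=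
  ∃ φ : Fin n → Fin n, IsEmbedding F (maxOrdering n) φ ∧ (φ v : ℕ) + 1 = n

/-- `F'` arises from `F` (embedded by `ι`) by adding one new vertex `u` and the single pendant edge
joining `u` to the vertex `v` of `F`; the edges of `F` keep their order. The position of the new
edge in the order is left open. -/
structure IsPendantExtension {V W : Type*} (F : EdgeOrderedGraph V) (v : V)
    (F' : EdgeOrderedGraph W) (ι : V → W) (u : W) : Prop where
  injective : Function.Injective ι
  range_eq : Set.range ι = {u}ᶜ
  adj_iff : ∀ x y, F'.graph.Adj (ι x) (ι y) ↔ F.graph.Adj x y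
  adj_new_iff : ∀ x, F'.graph.Adj u (ι x) ↔ x = v
  lt_iff : ∀ e e', F'.lt (e.map ι) (e'.map ι) ↔ F.lt e e'

/-- `F'` arises from `F` by adding a new vertex and joining it to the vertex `v` of `F` by a pendant
edge that is smaller than all edges of `F`. -/
def AddsSmallestPendant {V W : Type*} (F : EdgeOrderedGraph V) (v : V)
    (F' : EdgeOrderedGraph W) : Prop :=
  ∃ (ι : V → W) (u : W), IsPendantExtension F v F' ι u ∧
    ∀ e ∈ F.graph.edgeSet, F'.lt s(u, ι v) (e.map ι)

/-- `F'` arises from `F` by adding a new vertex and joining it to the vertex `v` of `F` by a pendant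
edge that is larger than all edges of `F`. -/
def AddsLargestPendant {V W : Type*} (F : EdgeOrderedGraph V) (v : V)
    (F' : EdgeOrderedGraph W) : Prop :=
  ∃ (ι : V → W) (u : W), IsPendantExtension F v F' ι u ∧
    ∀ e ∈ F.graph.edgeSet, F'.lt (e.map ι) s(u, ι v)

/-- The edges of `D₄` in increasing order. -/
def edgesD4 : List (Sym2 (Fin 4)) := [s(0, 1), s(0, 2), s(0, 3), s(1, 3), s(2, 3)]

/-- The edge-ordered graph `D₄` on `u₁, u₂, u₃, u₄` (here `0, 1, 2, 3`), with edges
`u₁u₂ < u₁u₃ < u₁u₄ < u₂u₄ < u₃u₄`. -/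
def D4 : EdgeOrderedGraph (Fin 4) :=
  ofLabeling (SimpleGraph.fromEdgeSet {e | e ∈ edgesD4}) (fun e => edgesD4.idxOf e) (by
    intro e he e' _ h
    rw [SimpleGraph.edgeSet_fromEdgeSet] at he
    exact (List.idxOf_inj he.1).mp h)

end EdgeOrderedGraph

/-- The graph `K₄⁻`: the complete graph on four vertices with one edge removed. -/
def K4Minus : SimpleGraph (Fin 4) := (⊤ : SimpleGraph (Fin 4)).deleteEdges {s(1, 2)}

/-! The witness is the broom: `D4` with small pendant edges at vertex `0` and large pendant edges at
vertex `3`. In increasing order its edges run through the star at `0`, up to the edge joining the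
two centres, and then through the star at `3`. An embedding therefore only needs a list of vertices
along which the edges at the first and at the last vertex increase
(`IsBroomList.exists_isEmbedding`).

Tileability comes from absorption. Put n = N + 1. By Ramsey, every large vertex set contains 2N + 1
vertices on which all triangles are ordered alike. Up to reversing the list there are three such
orders, and in each of them any N + 1 of the vertices span a double star, hence a broom. Moreover
there are two double stars on N vertices such that the first centre of one is the last centre c of
the other, and the highest edge at c in the latter is not above the lowest edge at c in the former.
An arbitrary outside vertex x then extends one of the two: if cx is low, x is a small leaf at c, and
otherwise it is a large leaf at c. The N + 1 unused vertices carry a second broom, so the set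
together with x is tiled (`IsAbsorbingList.isTiledSet_insert`). Both kinds of leaf must exist in the
broom, which is why n ≥ 6 is needed.

Absorbing sets are removed greedily until as many vertices remain as there are sets. Pairing the
leftovers with the sets tiles everything (`exists_reservoir`, `tileable_broom`).

`D4` itself is not tileable: if the edges at the first vertex of the min ordering are reversed, no
copy of `D4` covers that vertex (`IsEmbedding.val_ne_zero_of_reversedFirst`). -/

/-! ### Ramsey's theorem -/

/-- Ramsey's theorem for `r`-subsets and finitely many colours. -/
theorem exists_ramsey_number {κ : Type*} [Finite κ] (r m : ℕ) :
    ∃ N, ∀ (α : Type) [LinearOrder α] (c : Finset α → κ) (S : Finset α), N ≤ S.card →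
      ∃ T ⊆ S, T.card = m ∧ ∃ y, ∀ A ⊆ T, A.card = r → c A = y := by
  induction r generalizing m with
  | zero =>
    refine ⟨m, fun α _ c S hS => ?_⟩
    obtain ⟨T, hT, hTm⟩ := Finset.exists_subset_card_eq hS
    exact ⟨T, hT, hTm, c ∅, fun A _ hA => by rw [Finset.card_eq_zero.mp hA]⟩
  | succ r ih =>
    -- Weaker goal: a set of size `l` on which the colour of an `(r + 1)`-subset depends only on its
    -- minimum. Pigeonhole on that dependence then finishes the proof.
    have minHomogeneous : ∀ l : ℕ, ∃ N, ∀ (α : Type) [LinearOrder α] (c : Finset α → κ)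
        (S : Finset α), N ≤ S.card → ∃ T ⊆ S, T.card = l ∧ ∃ g : α → κ, ∀ A ⊆ T,
          A.card = r + 1 → ∀ a ∈ A, (∀ b ∈ A, a ≤ b) → c A = g a := by
      intro l
      induction l with
      | zero =>
        refine ⟨0, fun α _ c S _ => ⟨∅, by simp, rfl, fun _ => c ∅, fun A hA hc => ?_⟩⟩
        rw [Finset.subset_empty.mp hA] at hc
        simp at hc
      | succ l ihl =>
        obtain ⟨N₁, hN₁⟩ := ihl
        obtain ⟨N₂, hN₂⟩ := ih N₁
        refine ⟨N₂ + 1, fun α _ c S hS => ?_⟩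
        have hne : S.Nonempty := Finset.card_pos.mp (by omega)
        set v := S.min' hne with hv
        have hvS : v ∈ S := S.min'_mem hne
        -- Colouring `r`-sets by their union with the minimum `v` makes all sets with minimum `v`
        -- agree; the rest of the set is then refined inside `T₂`.
        obtain ⟨T₂, hT₂, hc₂, y, hy⟩ := hN₂ α (fun A => c (insert v A)) (S.erase v)
          (by rw [Finset.card_erase_of_mem hvS]; omega)
        obtain ⟨T₁, hT₁, hc₁, g, hg⟩ := hN₁ α c T₂ hc₂.ge
        have hvT : v ∉ T₁ := fun h => by simpa using hT₂ (hT₁ h)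
        have hsub : insert v T₁ ⊆ S :=
          Finset.insert_subset hvS ((hT₁.trans hT₂).trans (Finset.erase_subset _ _))
        refine ⟨insert v T₁, hsub, by rw [Finset.card_insert_of_notMem hvT, hc₁],
          Function.update g v y, fun A hA hcA a ha hmin => ?_⟩
        by_cases hvA : v ∈ A
        · have hav : a = v := le_antisymm (hmin v hvA) (S.min'_le a (hsub (hA ha)))
          rw [hav, Function.update_self, ← hy (A.erase v), Finset.insert_erase hvA]
          · intro b hb
            rw [Finset.mem_erase] at hb
            exact hT₁ ((Finset.mem_insert.mp (hA hb.2)).resolve_left hb.1)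
          · rw [Finset.card_erase_of_mem hvA]; omega
        · have hav : a ≠ v := fun h => hvA (h ▸ ha)
          rw [Function.update_of_ne hav]
          refine hg A (fun b hb => (Finset.mem_insert.mp (hA hb)).resolve_left ?_) hcA a ha hmin
          exact fun h => hvA (h ▸ hb)
    classical
    have := Fintype.ofFinite κ
    obtain ⟨N, hN⟩ := minHomogeneous (Fintype.card κ * m)
    refine ⟨N, fun α _ c S hS => ?_⟩
    obtain ⟨T, hT, hcT, g, hg⟩ := hN α c S hS
    have : Nonempty κ := ⟨c ∅⟩
    obtain ⟨y, -, hy⟩ := Finset.exists_le_card_fiber_of_mul_le_card_of_maps_to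
      (s := T) (t := (Finset.univ : Finset κ)) (f := g) (n := m) (fun _ _ => Finset.mem_univ _)
      Finset.univ_nonempty (by rw [hcT, Finset.card_univ])
    obtain ⟨U, hU, hUm⟩ := Finset.exists_subset_card_eq hy
    refine ⟨U, (hU.trans (Finset.filter_subset _ _)).trans hT, hUm, y, fun A hA hcA => ?_⟩
    have hne : A.Nonempty := Finset.card_pos.mp (by omega)
    have hmin := A.min'_mem hne
    rw [hg A ((hA.trans hU).trans (Finset.filter_subset _ _)) hcA _ hmin fun b hb => A.min'_le b hb]
    exact (Finset.mem_filter.mp (hU (hA hmin))).2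

namespace EdgeOrderedGraph

/-! ### Brooms and their embeddings -/

/-- The pairs `i < j` which are edges of the brooms below: the edges of `D₄` on `0, 1, 2, 3`, even
leaves `j ≥ 4` attached to `0` and odd leaves `j ≥ 5` attached to `3`. -/
def BroomEdge (i j : ℕ) : Prop :=
  i = 0 ∧ 1 ≤ j ∧ (j ≤ 3 ∨ j % 2 = 0) ∨ (i = 1 ∨ i = 2) ∧ j = 3 ∨ i = 3 ∧ 5 ≤ j ∧ j % 2 = 1

theorem BroomEdge.lt {i j : ℕ} (h : BroomEdge i j) : i < j := by
  unfold BroomEdge at h; omega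

/-- The label of the edge `i < j` of a broom. -/
def broomWeight (i j : ℕ) : ℤ :=
  if i = 0 then (if j ≤ 3 then j else -j) else if j ≤ 3 then i + 3 else j + 1

theorem broomWeight_inj {i j i' j' : ℕ} (h : BroomEdge i j) (h' : BroomEdge i' j')
    (hw : broomWeight i j = broomWeight i' j') : i = i' ∧ j = j' := by
  unfold BroomEdge at h h'
  unfold broomWeight at hw
  split_ifs at hw <;> omega

/-- The underlying graph of the broom on `n` vertices. -/
def broomGraph (n : ℕ) : SimpleGraph (Fin n) where
  Adj a b := BroomEdge a b ∨ BroomEdge b a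
  symm := ⟨fun _ _ h => h.symm⟩
  loopless := ⟨fun _ h => by rcases h with h | h <;> exact absurd h.lt (lt_irrefl _)⟩

/-- The label of an edge of a broom. -/
def broomLabel (n : ℕ) (e : Sym2 (Fin n)) : ℤ := broomWeight (e.inf : ℕ) (e.sup : ℕ)

theorem exists_broomEdge {n : ℕ} {e : Sym2 (Fin n)} (he : e ∈ (broomGraph n).edgeSet) :
    ∃ a b : Fin n, e = s(a, b) ∧ BroomEdge a b := by
  induction e using Sym2.ind with
  | _ a b =>
    rcases he with h | h
    · exact ⟨a, b, rfl, h⟩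
    · exact ⟨b, a, Sym2.eq_swap, h⟩

theorem broomLabel_mk {n : ℕ} {a b : Fin n} (h : BroomEdge a b) :
    broomLabel n s(a, b) = broomWeight a b := by
  have hab : a ≤ b := le_of_lt (Fin.lt_def.mpr h.lt)
  simp [broomLabel, hab]

/-- The broom on `n` vertices: the edge-ordered graph obtained from `D₄` by alternately adding
smallest pendant edges at `0` and largest pendant edges at `3`. -/
def broom (n : ℕ) : EdgeOrderedGraph (Fin n) :=
  ofLabeling (broomGraph n) (broomLabel n) (by
    intro e he e' he' h
    obtain ⟨a, b, rfl, hab⟩ := exists_broomEdge he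
    obtain ⟨c, d, rfl, hcd⟩ := exists_broomEdge he'
    rw [broomLabel_mk hab, broomLabel_mk hcd] at h
    obtain ⟨h₁, h₂⟩ := broomWeight_inj hab hcd h
    rw [Fin.ext h₁, Fin.ext h₂])

theorem mem_edgeSet_broom {n : ℕ} {a b : Fin n} (h : BroomEdge a b) :
    s(a, b) ∈ (broomGraph n).edgeSet := Or.inl h

theorem broom_lt_iff {n : ℕ} {a b c d : Fin n} (h : BroomEdge a b) (h' : BroomEdge c d) :
    (broom n).lt s(a, b) s(c, d) ↔ broomWeight a b < broomWeight c d := by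
  rw [← broomLabel_mk h, ← broomLabel_mk h']
  exact ⟨fun H => H.2.2, fun H => ⟨mem_edgeSet_broom h, mem_edgeSet_broom h', H⟩⟩

theorem exists_of_broom_lt {n : ℕ} {e e' : Sym2 (Fin n)} (h : (broom n).lt e e') :
    ∃ a b c d : Fin n, e = s(a, b) ∧ e' = s(c, d) ∧ BroomEdge a b ∧ BroomEdge c d ∧
      broomWeight a b < broomWeight c d := by
  obtain ⟨a, b, rfl, hab⟩ := exists_broomEdge h.1
  obtain ⟨c, d, rfl, hcd⟩ := exists_broomEdge h.2.1
  exact ⟨a, b, c, d, rfl, rfl, hab, hcd, (broom_lt_iff hab hcd).mp h⟩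

/-- A list of vertices `ψ 0, …, ψ N` containing a broom with `k` small leaves: centres `ψ 0` and
`ψ N`, small leaves `ψ 1, …, ψ k`, common neighbours `ψ (k + 1)` and `ψ (k + 2)`, and large leaves
`ψ (k + 3), …, ψ (N - 1)`. -/
structure IsBroomList {V : Type*} (H : EdgeOrderedGraph V) (k N : ℕ) (ψ : ℕ → V) : Prop where
  injOn : ∀ i j, i ≤ N → j ≤ N → ψ i = ψ j → i = j
  left : ∀ i j, 0 < i → i < j → (j ≤ k + 2 ∨ i ≤ k + 2 ∧ j = N) →
    H.lt s(ψ 0, ψ i) s(ψ 0, ψ j)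
  right : ∀ i j, i < j → (i = 0 ∨ k + 1 ≤ i) → k + 1 ≤ j → j < N →
    H.lt s(ψ N, ψ i) s(ψ N, ψ j)

/-- The position of the vertex `a` of the broom in a broom list with `k` small leaves. -/
def broomPos (k N a : ℕ) : ℕ :=
  if a = 0 then 0 else if a = 1 then k + 1 else if a = 2 then k + 2 else if a = 3 then N
  else if a % 2 = 0 then k - (a - 4) / 2 else k + 3 + (a - 5) / 2

theorem broomPos_le {n k N a : ℕ} (hn : 4 ≤ n) (hk : k = (n - 3) / 2) (hN : N + 1 = n)
    (ha : a < n) : broomPos k N a ≤ N := by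
  unfold broomPos
  split_ifs <;> omega

theorem broomPos_inj {n k N a b : ℕ} (hn : 4 ≤ n) (hk : k = (n - 3) / 2) (hN : N + 1 = n)
    (ha : a < n) (hb : b < n) (h : broomPos k N a = broomPos k N b) : a = b := by
  unfold broomPos at h
  split_ifs at h <;> omega

/-- Sorts the edges by centre, so that order comparisons reduce to comparisons of positions within
one star. The edge between the centres is counted with the first one. -/
theorem broomEdge_pos {V : Type*} (ψ : ℕ → V) {n k N i j : ℕ} (hn : 4 ≤ n) (hk : k = (n - 3) / 2)
    (hN : N + 1 = n) (hij : BroomEdge i j) (hj : j < n) :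
    (i = 0 ∧ 0 < broomPos k N j ∧ (broomPos k N j ≤ k + 2 ∧ j ≠ 3 ∨ broomPos k N j = N ∧ j = 3) ∧
      s(ψ (broomPos k N i), ψ (broomPos k N j)) = s(ψ 0, ψ (broomPos k N j))) ∨
    (i ≠ 0 ∧ ∃ p, p = broomPos k N (if j = 3 then i else j) ∧ k + 1 ≤ p ∧ p < N ∧
      s(ψ (broomPos k N i), ψ (broomPos k N j)) = s(ψ N, ψ p)) := by
  have h3 : broomPos k N 3 = N := by simp [broomPos]
  unfold BroomEdge at hij
  by_cases hi : i = 0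
  · subst hi
    refine Or.inl ⟨rfl, ?_, ?_, by simp [broomPos]⟩ <;> unfold broomPos <;> split_ifs <;> omega
  · refine Or.inr ⟨hi, _, rfl, ?_, ?_, ?_⟩
    · unfold broomPos; split_ifs <;> omega
    · unfold broomPos; split_ifs <;> omega
    · by_cases hj3 : j = 3
      · simp only [hj3, h3, if_true]; exact Sym2.eq_swap
      · have : i = 3 := by omega
        simp only [hj3, this, h3, if_false]

/-- Later leaves at `0` have smaller edges, and accordingly `broomPos` lists these leaves in
reverse. -/
theorem broomPos_lt_of_left {n k N b d : ℕ} (hn : 4 ≤ n) (hk : k = (n - 3) / 2) (hN : N + 1 = n)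
    (hb : b < n) (hd : d < n) (hab : BroomEdge 0 b) (hcd : BroomEdge 0 d)
    (hw : broomWeight 0 b < broomWeight 0 d) : broomPos k N b < broomPos k N d := by
  unfold BroomEdge at hab hcd
  unfold broomWeight at hw
  unfold broomPos
  split_ifs at hw ⊢ <;> omega

theorem broomWeight_broomPos_right {k N a b : ℕ} (hab : BroomEdge a b) (ha : a ≠ 0) :
    (b = 3 ∧ broomWeight a b = a + 3 ∧ broomPos k N (if b = 3 then a else b) = k + a ∧ a ≤ 2) ∨
    (5 ≤ b ∧ b % 2 = 1 ∧ broomWeight a b = b + 1 ∧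
      broomPos k N (if b = 3 then a else b) = k + 3 + (b - 5) / 2) := by
  unfold BroomEdge at hab
  rcases hab with h | ⟨h, rfl⟩ | ⟨rfl, h5, h2⟩
  · exact absurd h.1 ha
  · rcases h with rfl | rfl <;> simp [broomWeight, broomPos]
  · refine Or.inr ⟨h5, h2, ?_, ?_⟩
    · rw [broomWeight, if_neg ha, if_neg (by omega)]
    · rw [if_neg (by omega), broomPos, if_neg (by omega), if_neg (by omega), if_neg (by omega),
        if_neg (by omega), if_neg (by omega)]

theorem broomPos_lt_of_right {k N a b c d : ℕ} (hab : BroomEdge a b) (hcd : BroomEdge c d)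
    (ha : a ≠ 0) (hc : c ≠ 0) (hw : broomWeight a b < broomWeight c d) :
    broomPos k N (if b = 3 then a else b) < broomPos k N (if d = 3 then c else d) := by
  rcases broomWeight_broomPos_right (k := k) (N := N) hab ha with h | h <;>
  rcases broomWeight_broomPos_right (k := k) (N := N) hcd hc with h' | h' <;>
  omega

/-- The edge joining `ψ 0` and `ψ N` is the top of the first star and the bottom of the second, so
the two increasing stars concatenate into one chain with the order type of the broom. -/
theorem IsBroomList.exists_isEmbedding {V : Type*} {H : EdgeOrderedGraph V} (hH : H.graph = ⊤)
    {n k N : ℕ} {ψ : ℕ → V} (hn : 4 ≤ n) (hk : k = (n - 3) / 2) (hN : N + 1 = n)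
    (h : IsBroomList H k N ψ) :
    ∃ φ : Fin n → V, IsEmbedding (broom n) H φ ∧ Set.range φ = ψ '' Set.Iio n ∧
      φ ⟨0, by omega⟩ = ψ 0 ∧ φ ⟨3, by omega⟩ = ψ N := by
  have hle : ∀ a : Fin n, broomPos k N a ≤ N := fun a => broomPos_le hn hk hN a.2
  have hinj : Function.Injective fun a : Fin n => ψ (broomPos k N a) := fun a b hab =>
    Fin.ext (broomPos_inj hn hk hN a.2 b.2 (h.injOn _ _ (hle a) (hle b) hab))
  refine ⟨fun a => ψ (broomPos k N a), ⟨hinj, fun u v huv => ?_, fun e e' hlt => ?_⟩,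
    ?_, by simp [broomPos], by simp [broomPos]⟩
  · rw [hH]
    exact hinj.ne huv.ne
  · obtain ⟨a, b, c, d, rfl, rfl, hab, hcd, hw⟩ := exists_of_broom_lt hlt
    obtain ⟨a, ha⟩ := a
    obtain ⟨b, hb⟩ := b
    obtain ⟨c, hc⟩ := c
    obtain ⟨d, hd⟩ := d
    simp only [Sym2.map_mk] at hab hcd hw ⊢
    rcases broomEdge_pos ψ hn hk hN hab hb with ⟨ha0, hpos, hp, he⟩ | ⟨ha0, p, hpe, hp, hpN, he⟩ <;>
    rcases broomEdge_pos ψ hn hk hN hcd hd with ⟨hc0, hpos', hp', he'⟩ | ⟨hc0, p', hpe', hp', hpN', he'⟩ <;>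
    rw [he, he']
    · refine h.left _ _ hpos ?_ ?_
      · subst ha0 hc0
        exact broomPos_lt_of_left hn hk hN hb hd hab hcd hw
      · rcases hp' with hp' | hp'
        · exact Or.inl hp'.1
        · refine Or.inr ⟨?_, hp'.1⟩
          rcases hp with hp | hp
          · exact hp.1
          · subst ha0 hc0
            rw [hp.2, hp'.2] at hw
            exact absurd hw (lt_irrefl _)
    · have hlast : H.lt s(ψ N, ψ 0) s(ψ N, ψ p') := h.right 0 p' (by omega) (Or.inl rfl) hp' hpN'
      rw [Sym2.eq_swap] at hlast
      rcases hp with hp | hp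
      · exact H.trans _ _ _ (h.left _ N hpos (by omega) (Or.inr ⟨hp.1, rfl⟩)) hlast
      · rwa [hp.1]
    -- Edges at `0` have weight at most 3, all others at least 4.
    · exfalso
      unfold BroomEdge at hab hcd
      unfold broomWeight at hw
      split_ifs at hw <;> omega
    · refine h.right p p' ?_ (Or.inr hp) hp' hpN'
      subst hpe hpe'
      exact broomPos_lt_of_right hab hcd ha0 hc0 hw
  · have hsurj : Function.Surjective
        fun a : Fin n => (⟨broomPos k N a, by have := hle a; omega⟩ : Fin n) := by
      refine Finite.surjective_of_injective fun a b hab => ?_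
      exact Fin.ext (broomPos_inj hn hk hN a.2 b.2 (Fin.mk.inj_iff.mp hab))
    ext x
    constructor
    · rintro ⟨a, rfl⟩
      exact ⟨_, by have := hle a; simp only [Set.mem_Iio]; omega, rfl⟩
    · rintro ⟨i, hi, rfl⟩
      obtain ⟨a, ha⟩ := hsurj ⟨i, hi⟩
      exact ⟨a, congrArg ψ (Fin.mk.inj_iff.mp ha)⟩

end EdgeOrderedGraph

namespace EdgeOrderedGraph

variable {V : Type*} {H : EdgeOrderedGraph V}

/-! ### Double stars and insertion of a vertex -/

/-- The edges at `ψ 0` and the edges at `ψ N` increase along the list `ψ 0, …, ψ N`. -/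
structure IsDoubleStar (H : EdgeOrderedGraph V) (N : ℕ) (ψ : ℕ → V) : Prop where
  injOn : ∀ i j, i ≤ N → j ≤ N → ψ i = ψ j → i = j
  left : ∀ i j, 0 < i → i < j → j ≤ N → H.lt s(ψ 0, ψ i) s(ψ 0, ψ j)
  right : ∀ i j, i < j → j < N → H.lt s(ψ N, ψ i) s(ψ N, ψ j)

theorem IsDoubleStar.isBroomList {N k : ℕ} {ψ : ℕ → V} (h : IsDoubleStar H N ψ) (hk : k + 2 ≤ N) :
    IsBroomList H k N ψ where
  injOn := h.injOn
  left i j hi hij hj := h.left i j hi hij (by omega)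
  right i j hij _ _ hj := h.right i j hij hj

/-- A vertex `x` joined to the first vertex of a double star by an edge below the star edges serves
as an additional small leaf. -/
theorem IsDoubleStar.insert_small {N k : ℕ} {ψ : ℕ → V} {x : V} (h : IsDoubleStar H N ψ)
    (hk : 1 ≤ k) (hkN : k + 2 ≤ N) (hx : ∀ i ≤ N, ψ i ≠ x)
    (hlt : H.lt s(ψ 0, x) s(ψ 0, ψ 1)) :
    IsBroomList H k (N + 1) (fun i => if i = 0 then ψ 0 else if i = 1 then x else ψ (i - 1)) where
  injOn i j hi hj hij := by
    split_ifs at hij <;> first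
      | omega
      | exact absurd hij (hx _ (by omega))
      | exact absurd hij.symm (hx _ (by omega))
      | (have := h.injOn _ _ (by omega) (by omega) hij; omega)
  left i j hi hij hj := by
    have hj1 : j ≠ 1 := by omega
    have hj0 : j ≠ 0 := by omega
    have hi0 : i ≠ 0 := by omega
    simp only [if_true, hi0, hj0, hj1, if_false]
    split_ifs with hi1
    · rcases (show 1 ≤ j - 1 by omega).eq_or_lt with h1 | h1
      · rwa [← h1]
      · exact H.trans _ _ _ hlt (h.left _ _ one_pos h1 (by omega))
    · exact h.left _ _ (by omega) (by omega) (by omega)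
  right i j hij hi hj hjN := by
    -- Since `1 ≤ k`, position 1, occupied by `x`, is a small leaf, and nothing is required of its
    -- edge to the last centre.
    have hj1 : j ≠ 1 := by omega
    have hj0 : j ≠ 0 := by omega
    have hN1 : N + 1 ≠ 1 := by omega
    have hi1 : i ≠ 1 := by omega
    simp only [hj0, hj1, hN1, hi1, if_false, Nat.add_eq_zero_iff, one_ne_zero, and_false,
      Nat.add_sub_cancel]
    split_ifs with hi0
    · exact h.right _ _ (by omega) (by omega)
    · exact h.right _ _ (by omega) (by omega)

/-- A vertex `x` joined to the last vertex of a double star by an edge above the star edges serves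
as an additional large leaf. -/
theorem IsDoubleStar.insert_large {N k : ℕ} {ψ : ℕ → V} {x : V} (h : IsDoubleStar H N ψ)
    (hkN : k + 3 ≤ N) (hx : ∀ i ≤ N, ψ i ≠ x)
    (hlt : H.lt s(ψ N, ψ (N - 1)) s(ψ N, x)) :
    IsBroomList H k (N + 1)
      (fun i => if i < N then ψ i else if i = N then x else ψ (i - 1)) where
  injOn i j hi hj hij := by
    split_ifs at hij <;> first
      | omega
      | exact absurd hij (hx _ (by omega))
      | exact absurd hij.symm (hx _ (by omega))
      | (have := h.injOn _ _ (by omega) (by omega) hij; omega)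
  left i j hi hij hj := by
    have hN0 : 0 < N := by omega
    -- Since `k + 3 ≤ N`, position `N`, occupied by `x`, is a large leaf, and nothing is required of
    -- its edge to the first centre.
    have hjN : j ≠ N := by omega
    have hiN : i < N := by omega
    simp only [hN0, hiN, hjN, if_true, if_false]
    split_ifs with hj'
    · exact h.left _ _ hi hij hj'.le
    · exact h.left _ _ hi (by omega) (by omega)
  right i j hij hi hj hjN := by
    have hiN : i < N := by omega
    have h1 : ¬ N + 1 < N := by omega
    have h2 : N + 1 ≠ N := by omega
    simp only [hiN, h1, h2, if_true, if_false, Nat.add_sub_cancel]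
    split_ifs with hj' hj''
    · exact h.right _ _ hij hj'
    · rcases (show i ≤ N - 1 by omega).eq_or_lt with h3 | h3
      · rwa [h3]
      · exact H.trans _ _ _ (h.right _ _ h3 (by omega)) hlt
    · omega

/-! ### Tilings and absorbing lists -/

/-- The vertex set `W` can be tiled with copies of `F` in `H`. -/
def IsTiledSet {U : Type*} (H : EdgeOrderedGraph V) (F : EdgeOrderedGraph U) (W : Set V) : Prop :=
  ∃ T : Set (U → V), (∀ φ ∈ T, IsEmbedding F H φ) ∧
    T.PairwiseDisjoint (fun φ => Set.range φ) ∧ (⋃ φ ∈ T, Set.range φ) = W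

theorem isTiledSet_empty {U : Type*} (F : EdgeOrderedGraph U) : IsTiledSet H F ∅ :=
  ⟨∅, by simp, by simp, by simp⟩

theorem IsEmbedding.isTiledSet {U : Type*} {F : EdgeOrderedGraph U} {φ : U → V}
    (h : IsEmbedding F H φ) : IsTiledSet H F (Set.range φ) :=
  ⟨{φ}, by simpa using h, by simp, by simp⟩

theorem IsTiledSet.union {U : Type*} {F : EdgeOrderedGraph U} {W W' : Set V}
    (h : IsTiledSet H F W) (h' : IsTiledSet H F W') (hd : Disjoint W W') :
    IsTiledSet H F (W ∪ W') := by
  obtain ⟨T, hT, hTd, rfl⟩ := h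
  obtain ⟨T', hT', hTd', rfl⟩ := h'
  refine ⟨T ∪ T', ?_, ?_, Set.biUnion_union _ _ _⟩
  · rintro φ (hφ | hφ)
    exacts [hT φ hφ, hT' φ hφ]
  · refine hTd.union hTd' fun φ hφ φ' hφ' _ => ?_
    exact hd.mono (Set.subset_biUnion_of_mem (u := fun φ : U → V => Set.range φ) hφ)
      (Set.subset_biUnion_of_mem (u := fun φ : U → V => Set.range φ) hφ')

theorem IsBroomList.isTiledSet (hH : H.graph = ⊤) {n k N : ℕ} {ψ : ℕ → V} (hn : 4 ≤ n)
    (hk : k = (n - 3) / 2) (hN : N + 1 = n) (h : IsBroomList H k N ψ) :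
    IsTiledSet H (broom n) (ψ '' Set.Iio n) := by
  obtain ⟨φ, hφ, hr, -⟩ := h.exists_isEmbedding hH hn hk hN
  exact hr ▸ hφ.isTiledSet

theorem lt_or_lt (hH : H.graph = ⊤) {a b c : V} (hab : a ≠ b) (hac : a ≠ c) (hbc : b ≠ c) :
    H.lt s(a, b) s(a, c) ∨ H.lt s(a, c) s(a, b) := by
  refine H.total _ ?_ _ ?_ fun h => hbc (Sym2.congr_right.mp h)
  · rw [hH]; exact hab
  · rw [hH]; exact hac

/-- A list of `m` vertices which contains, on every set of `N + 1` of its vertices, a double star,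
and in addition two double stars on `N` vertices, the first vertex of one being the last vertex of
the other, with the star of the former at this vertex above the star of the latter. -/
structure IsAbsorbingList (H : EdgeOrderedGraph V) (N m : ℕ) (v : ℕ → V) : Prop where
  injOn : ∀ i j, i < m → j < m → v i = v j → i = j
  double_star : ∀ e : ℕ → ℕ, (∀ i j, i < j → j ≤ N → e i < e j) → (∀ i ≤ N, e i < m) →
    ∃ π : ℕ → ℕ, IsDoubleStar H N (fun i => v (e (π i))) ∧ π '' Set.Iio (N + 1) = Set.Iio (N + 1)
  pair : ∃ p p' : ℕ → ℕ, (∀ i < N, p i < m) ∧ (∀ i < N, p' i < m) ∧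
    IsDoubleStar H (N - 1) (v ∘ p) ∧ IsDoubleStar H (N - 1) (v ∘ p') ∧ p 0 = p' (N - 1) ∧
    (s(v (p' (N - 1)), v (p' (N - 2))) = s(v (p 0), v (p 1)) ∨
      H.lt s(v (p' (N - 1)), v (p' (N - 2))) s(v (p 0), v (p 1)))

theorem IsAbsorbingList.isTiledSet_image (hH : H.graph = ⊤) {N m : ℕ} {v : ℕ → V} (hN : 3 ≤ N)
    (h : IsAbsorbingList H N m v) {U : Finset ℕ} (hU : U.card = N + 1)
    (hUm : ∀ i ∈ U, i < m) : IsTiledSet H (broom (N + 1)) (v '' U) := by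
  -- Increasing enumeration of `U`; the value 0 outside the range is never used.
  let e : ℕ → ℕ := fun i => if hi : i < N + 1 then U.orderEmbOfFin hU ⟨i, hi⟩ else 0
  have he : ∀ i (hi : i < N + 1), e i = U.orderEmbOfFin hU ⟨i, hi⟩ := fun i hi => dif_pos hi
  obtain ⟨π, hπ, himg⟩ := h.double_star e (fun i j hij hj => by
      rw [he i (by omega), he j (by omega)]
      exact (U.orderEmbOfFin hU).strictMono hij) (fun i hi => by
      rw [he i (by omega)]
      exact hUm _ (U.orderEmbOfFin_mem hU _))
  have := (hπ.isBroomList (k := (N + 1 - 3) / 2) (by omega)).isTiledSet hH (n := N + 1)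
    (by omega) rfl rfl
  convert this using 1
  have h1 : (fun i => v (e (π i))) = v ∘ e ∘ π := rfl
  have h2 : e '' Set.Iio (N + 1) = U := by
    rw [← U.range_orderEmbOfFin hU]
    ext x
    constructor
    · rintro ⟨i, hi, rfl⟩
      exact ⟨_, (he i hi).symm⟩
    · rintro ⟨i, rfl⟩
      exact ⟨i, i.2, he i i.2⟩
  rw [h1, Set.image_comp, Set.image_comp, himg, h2]

/-- The edge from `x` to the common centre of the pair is compared with the lowest edge there of the
double star starting at it. One of the two double stars absorbs `x`, and what is left is again large
enough for a double star. -/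
theorem IsAbsorbingList.isTiledSet_insert (hH : H.graph = ⊤) {N m : ℕ} {v : ℕ → V} (hN : 5 ≤ N)
    (hm : m = 2 * N + 1) (h : IsAbsorbingList H N m v) {x : V} (hx : x ∉ v '' Set.Iio m) :
    IsTiledSet H (broom (N + 1)) (insert x (v '' Set.Iio m)) := by
  have hxv : ∀ i < m, v i ≠ x := fun i hi hix => hx ⟨i, hi, hix⟩
  suffices hsuff : ∃ q : ℕ → ℕ, (∀ i < N, q i < m) ∧ IsDoubleStar H (N - 1) (v ∘ q) ∧
      IsTiledSet H (broom (N + 1)) (insert x (v '' (q '' Set.Iio N))) by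
    obtain ⟨q, hqm, hq, htile⟩ := hsuff
    set Q := (Finset.range N).image q with hQ
    have hQm : Q ⊆ Finset.range m := by
      intro i hi
      obtain ⟨j, hj, rfl⟩ := Finset.mem_image.mp hi
      exact Finset.mem_range.mpr (hqm j (Finset.mem_range.mp hj))
    have hQc : Q.card = N := by
      rw [hQ, Finset.card_image_of_injOn, Finset.card_range]
      intro i hi j hj hij
      simp only [Finset.coe_range, Set.mem_Iio] at hi hj
      exact hq.injOn i j (by omega) (by omega) (congrArg v hij)
    have hQs : q '' Set.Iio N = Q := by simp [hQ]
    rw [hQs] at htile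
    -- Exactly (2N + 1) - N = N + 1 vertices remain, the size of one broom.
    have hrest := h.isTiledSet_image hH (by omega) (U := Finset.range m \ Q)
      (by rw [Finset.card_sdiff_of_subset hQm, hQc, Finset.card_range]; omega)
      (fun i hi => Finset.mem_range.mp (Finset.mem_sdiff.mp hi).1)
    have hun := htile.union hrest ?_
    · convert hun using 1
      rw [Set.insert_union, ← Set.image_union, ← Finset.coe_union, Finset.union_sdiff_of_subset hQm,
        Finset.coe_range]
    · rw [Set.disjoint_left]
      rintro y hy ⟨i, hi, rfl⟩
      have hi' := Finset.mem_sdiff.mp (Finset.mem_coe.mp hi)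
      have him := Finset.mem_range.mp hi'.1
      rcases hy with hy | ⟨j, hj, hij⟩
      · exact hxv i him hy
      · have := h.injOn j i (Finset.mem_range.mp (hQm hj)) him hij
        exact hi'.2 (this ▸ hj)
  obtain ⟨p, p', hp, hp', hs, hs', hpp, hcmp⟩ := h.pair
  have hN1 : N - 1 + 1 = N := by omega
  have hne : v (p 0) ≠ v (p 1) := fun h0 => by
    have := hs.injOn 0 1 (by omega) (by omega) h0; omega
  rcases lt_or_lt hH (a := v (p 0)) (b := x) (c := v (p 1)) (hxv _ (hp 0 (by omega))) hne
    (hxv _ (hp 1 (by omega))).symm with hlt | hlt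
  · refine ⟨p, hp, hs, ?_⟩
    have := (hs.insert_small (k := (N + 1 - 3) / 2) (by omega) (by omega)
      (fun i hi => hxv _ (hp i (by omega))) hlt).isTiledSet hH (n := N + 1) (by omega) rfl
      (by omega)
    convert this using 1
    ext y
    simp only [Set.mem_insert_iff, Set.mem_image, Set.mem_Iio]
    constructor
    · rintro (rfl | ⟨_, ⟨i, hi, rfl⟩, rfl⟩)
      · exact ⟨1, by omega, by simp⟩
      · rcases Nat.eq_zero_or_pos i with rfl | hi0
        · exact ⟨0, by omega, by simp⟩
        · exact ⟨i + 1, by omega, by simp [hi0.ne']⟩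
    · rintro ⟨i, hi, rfl⟩
      split_ifs with h0 h1
      · exact Or.inr ⟨_, ⟨0, by omega, rfl⟩, rfl⟩
      · exact Or.inl rfl
      · exact Or.inr ⟨_, ⟨i - 1, by omega, rfl⟩, rfl⟩
  · refine ⟨p', hp', hs', ?_⟩
    -- The edge to `x` is above the lowest edge of `p` at the centre, hence above the highest edge
    -- of `p'` there.
    have hlt' : H.lt s(v (p' (N - 1)), v (p' (N - 2))) s(v (p' (N - 1)), x) := by
      rw [← hpp] at hcmp ⊢
      rcases hcmp with hcmp | hcmp
      · rwa [hcmp]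
      · exact H.trans _ _ _ hcmp hlt
    have := (hs'.insert_large (k := (N + 1 - 3) / 2) (by omega)
      (fun i hi => hxv _ (hp' i (by omega)))
      (by rwa [show N - 1 - 1 = N - 2 by omega])).isTiledSet hH (n := N + 1) (by omega) rfl
      (by omega)
    convert this using 1
    ext y
    simp only [Set.mem_insert_iff, Set.mem_image, Set.mem_Iio]
    constructor
    · rintro (rfl | ⟨_, ⟨i, hi, rfl⟩, rfl⟩)
      · exact ⟨N - 1, by omega, by simp⟩
      · by_cases hi1 : i < N - 1
        · exact ⟨i, by omega, by simp [hi1]⟩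
        · refine ⟨N, by omega, ?_⟩
          have : i = N - 1 := by omega
          subst this
          simp [show N ≠ N - 1 by omega]
    · rintro ⟨i, hi, rfl⟩
      split_ifs with h0 h1
      · exact Or.inr ⟨_, ⟨i, by omega, rfl⟩, rfl⟩
      · exact Or.inl rfl
      · exact Or.inr ⟨_, ⟨i - 1, by omega, rfl⟩, rfl⟩

end EdgeOrderedGraph

namespace EdgeOrderedGraph

variable {V : Type*} {H : EdgeOrderedGraph V}

/-! ### Homogeneous lists are absorbing -/

theorem isDoubleStar_of_increasing {v : ℕ → V} {m N : ℕ} {e : ℕ → ℕ}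
    (hv : ∀ i j, i < m → j < m → v i = v j → i = j)
    (h : ∀ i j k, i < j → j < k → k < m →
      H.lt s(v i, v j) s(v i, v k) ∧ H.lt s(v i, v k) s(v j, v k))
    (he : ∀ i j, i < j → j ≤ N → e i < e j) (hem : ∀ i ≤ N, e i < m) :
    IsDoubleStar H N (fun i => v (e i)) where
  injOn i j hi hj hij := by
    have := hv _ _ (hem i hi) (hem j hj) hij
    rcases lt_trichotomy i j with h' | h' | h'
    · exact absurd this (he i j h' hj).ne
    · exact h'
    · exact absurd this (he j i h' hi).ne'
  left i j hi hij hj := (h _ _ _ (he 0 i hi (by omega)) (he i j hij hj) (hem j hj)).1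
  right i j hij hj := by
    rw [Sym2.eq_swap, Sym2.eq_swap (a := v (e N))]
    exact (h _ _ _ (he i j hij hj.le) (he j N hj le_rfl) (hem N le_rfl)).2

/-- The order in which a list whose triples are ordered `13 < 12 < 23` becomes a double star. -/
def nearReverse (N i : ℕ) : ℕ := if i = 0 then 0 else N + 1 - i

/-- The order in which a list whose triples are ordered `12 < 23 < 13` becomes a double star. -/
def farReverse (N i : ℕ) : ℕ := if i = N then N else N - 1 - i

theorem nearReverse_image {N : ℕ} : nearReverse N '' Set.Iio (N + 1) = Set.Iio (N + 1) := by
  ext x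
  simp only [Set.mem_image, Set.mem_Iio, nearReverse]
  constructor
  · rintro ⟨i, hi, rfl⟩
    split_ifs <;> omega
  · intro hx
    refine ⟨if x = 0 then 0 else N + 1 - x, ?_, ?_⟩ <;> split_ifs <;> omega

theorem farReverse_image {N : ℕ} : farReverse N '' Set.Iio (N + 1) = Set.Iio (N + 1) := by
  ext x
  simp only [Set.mem_image, Set.mem_Iio, farReverse]
  constructor
  · rintro ⟨i, hi, rfl⟩
    split_ifs <;> omega
  · intro hx
    refine ⟨if x = N then N else N - 1 - x, ?_, ?_⟩ <;> split_ifs <;> omega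

theorem isDoubleStar_nearReverse {v : ℕ → V} {m N : ℕ} {e : ℕ → ℕ} (hN : 1 ≤ N)
    (hv : ∀ i j, i < m → j < m → v i = v j → i = j)
    (h : ∀ i j k, i < j → j < k → k < m →
      H.lt s(v i, v k) s(v i, v j) ∧ H.lt s(v i, v j) s(v j, v k))
    (he : ∀ i j, i < j → j ≤ N → e i < e j) (hem : ∀ i ≤ N, e i < m) :
    IsDoubleStar H N (fun i => v (e (nearReverse N i))) where
  injOn i j hi hj hij := by
    have hle : ∀ a ≤ N, nearReverse N a ≤ N := fun a ha => by
      unfold nearReverse; split_ifs <;> omega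
    have h1 := hv _ _ (hem _ (hle i hi)) (hem _ (hle j hj)) hij
    have h2 : nearReverse N i = nearReverse N j := by
      rcases lt_trichotomy (nearReverse N i) (nearReverse N j) with h' | h' | h'
      · exact absurd h1 (he _ _ h' (hle j hj)).ne
      · exact h'
      · exact absurd h1 (he _ _ h' (hle i hi)).ne'
    unfold nearReverse at h2
    split_ifs at h2 <;> omega
  left i j hi hij hj := by
    have hi0 : i ≠ 0 := by omega
    have hj0 : j ≠ 0 := by omega
    simp only [nearReverse, if_true, hi0, hj0, if_false]
    exact (h _ _ _ (he 0 (N + 1 - j) (by omega) (by omega))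
      (he (N + 1 - j) (N + 1 - i) (by omega) (by omega)) (hem _ (by omega))).1
  right i j hij hj := by
    have hN0 : N ≠ 0 := by omega
    have hj0 : j ≠ 0 := by omega
    simp only [nearReverse, hN0, hj0, if_false, Nat.add_sub_cancel_left]
    split_ifs with hi0
    · rw [Sym2.eq_swap]
      exact (h _ _ _ (he 0 1 (by omega) (by omega))
        (he 1 (N + 1 - j) (by omega) (by omega)) (hem _ (by omega))).2
    · exact (h _ _ _ (he 1 (N + 1 - j) (by omega) (by omega))
        (he (N + 1 - j) (N + 1 - i) (by omega) (by omega)) (hem _ (by omega))).1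

theorem isDoubleStar_farReverse {v : ℕ → V} {m N : ℕ} {e : ℕ → ℕ} (hN : 1 ≤ N)
    (hv : ∀ i j, i < m → j < m → v i = v j → i = j)
    (h : ∀ i j k, i < j → j < k → k < m →
      H.lt s(v i, v j) s(v j, v k) ∧ H.lt s(v j, v k) s(v i, v k))
    (he : ∀ i j, i < j → j ≤ N → e i < e j) (hem : ∀ i ≤ N, e i < m) :
    IsDoubleStar H N (fun i => v (e (farReverse N i))) where
  injOn i j hi hj hij := by
    have hle : ∀ a ≤ N, farReverse N a ≤ N := fun a ha => by
      unfold farReverse; split_ifs <;> omega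
    have h1 := hv _ _ (hem _ (hle i hi)) (hem _ (hle j hj)) hij
    have h2 : farReverse N i = farReverse N j := by
      rcases lt_trichotomy (farReverse N i) (farReverse N j) with h' | h' | h'
      · exact absurd h1 (he _ _ h' (hle j hj)).ne
      · exact h'
      · exact absurd h1 (he _ _ h' (hle i hi)).ne'
    unfold farReverse at h2
    split_ifs at h2 <;> omega
  left i j hi hij hj := by
    have hi0 : i ≠ N := by omega
    have h0 : 0 ≠ N := by omega
    simp only [farReverse, h0, hi0, if_false, Nat.sub_zero]
    rw [Sym2.eq_swap]
    split_ifs with hjN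
    · exact (h _ _ _ (he (N - 1 - i) (N - 1) (by omega) (by omega))
        (he (N - 1) N (by omega) (by omega)) (hem _ (by omega))).1
    · rw [Sym2.eq_swap (a := v (e (N - 1)))]
      exact (h _ _ _ (he (N - 1 - j) (N - 1 - i) (by omega) (by omega))
        (he (N - 1 - i) (N - 1) (by omega) (by omega)) (hem _ (by omega))).2
  right i j hij hj := by
    have hiN : i ≠ N := by omega
    have hjN : j ≠ N := by omega
    simp only [farReverse, hiN, hjN, if_false, if_true]
    rw [Sym2.eq_swap, Sym2.eq_swap (a := v (e N))]
    exact (h _ _ _ (he (N - 1 - j) (N - 1 - i) (by omega) (by omega))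
      (he (N - 1 - i) N (by omega) (by omega)) (hem _ (by omega))).2

theorem isAbsorbingList_of_increasing {v : ℕ → V} {m N : ℕ} (hN : 3 ≤ N) (hm : m = 2 * N + 1)
    (hv : ∀ i j, i < m → j < m → v i = v j → i = j)
    (h : ∀ i j k, i < j → j < k → k < m →
      H.lt s(v i, v j) s(v i, v k) ∧ H.lt s(v i, v k) s(v j, v k)) :
    IsAbsorbingList H N m v where
  injOn := hv
  double_star e he hem := ⟨id, isDoubleStar_of_increasing hv h he hem, Set.image_id _⟩
  pair := by
    -- Two consecutive intervals sharing the vertex `N - 1`: all edges from it to the left lie below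
    -- those to the right.
    refine ⟨fun i => N - 1 + i, fun i => i, fun i hi => by dsimp only; omega,
      fun i hi => by dsimp only; omega,
      isDoubleStar_of_increasing (e := fun i => N - 1 + i) hv h (fun i j _ _ => by omega)
        (fun i hi => by omega),
      isDoubleStar_of_increasing (e := fun i => i) hv h (fun i j _ _ => by omega)
        (fun i hi => by omega),
      rfl, Or.inr ?_⟩
    have := h (N - 2) (N - 1) (N - 1 + 1) (by omega) (by omega) (by omega)
    rw [Sym2.eq_swap]
    exact H.trans _ _ _ this.1 this.2

theorem isAbsorbingList_nearReverse {v : ℕ → V} {m N : ℕ} (hN : 3 ≤ N) (hm : m = 2 * N + 1)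
    (hv : ∀ i j, i < m → j < m → v i = v j → i = j)
    (h : ∀ i j k, i < j → j < k → k < m →
      H.lt s(v i, v k) s(v i, v j) ∧ H.lt s(v i, v j) s(v j, v k)) :
    IsAbsorbingList H N m v where
  injOn := hv
  double_star e he hem := ⟨nearReverse N, isDoubleStar_nearReverse (by omega) hv h he hem,
    nearReverse_image⟩
  pair := by
    have hle : ∀ a < N, nearReverse (N - 1) a ≤ N - 1 := fun a ha => by
      unfold nearReverse; split_ifs <;> omega
    -- The vertex sets are {1, …, N} and {0, 1, N, …, 2N - 3}, with common centre 1. The lowest edge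
    -- at 1 of the first and the highest edge at 1 of the second are the same edge, to vertex `N`.
    -- The overlap is harmless, since only one of the two is used.
    refine ⟨fun i => 1 + nearReverse (N - 1) i,
      fun i => (fun a => if a < 2 then a else N - 2 + a) (nearReverse (N - 1) i),
      fun i hi => by have := hle i hi; dsimp only; omega, fun i hi => ?_,
      isDoubleStar_nearReverse (e := fun a => 1 + a) (by omega) hv h
        (fun i j _ _ => by omega) (fun i hi => by omega),
      isDoubleStar_nearReverse (e := fun a => if a < 2 then a else N - 2 + a) (by omega) hv h
        (fun i j _ _ => ?_) (fun i hi => ?_), ?_, Or.inl ?_⟩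
    · have := hle i hi
      dsimp only
      split_ifs <;> omega
    · split_ifs <;> omega
    · split_ifs <;> omega
    · simp only [nearReverse]
      split_ifs <;> omega
    · have h1 : nearReverse (N - 1) (N - 1) = 1 := by unfold nearReverse; split_ifs <;> omega
      have h2 : nearReverse (N - 1) (N - 2) = 2 := by unfold nearReverse; split_ifs <;> omega
      have h3 : nearReverse (N - 1) 1 = N - 1 := by simp [nearReverse]
      simp only [h1, h2, h3, show nearReverse (N - 1) 0 = 0 from rfl]
      simp [show N - 2 + 2 = 1 + (N - 1) by omega]

theorem isAbsorbingList_farReverse {v : ℕ → V} {m N : ℕ} (hN : 3 ≤ N) (hm : m = 2 * N + 1)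
    (hv : ∀ i j, i < m → j < m → v i = v j → i = j)
    (h : ∀ i j k, i < j → j < k → k < m →
      H.lt s(v i, v j) s(v j, v k) ∧ H.lt s(v j, v k) s(v i, v k)) :
    IsAbsorbingList H N m v where
  injOn := hv
  double_star e he hem := ⟨farReverse N, isDoubleStar_farReverse (by omega) hv h he hem,
    farReverse_image⟩
  pair := by
    have hle : ∀ a < N, farReverse (N - 1) a ≤ N - 1 := fun a ha => by
      unfold farReverse; split_ifs <;> omega
    -- The vertex sets are {3, …, N, 2N - 1, 2N} and {N, …, 2N - 1}, with common centre 2N - 1. The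
    -- two edges to be compared again coincide, both going to vertex `N`.
    refine ⟨fun i => (fun a => if a < N - 2 then 3 + a else N + 1 + a) (farReverse (N - 1) i),
      fun i => N + farReverse (N - 1) i, fun i hi => ?_,
      fun i hi => by have := hle i hi; dsimp only; omega,
      isDoubleStar_farReverse (e := fun a => if a < N - 2 then 3 + a else N + 1 + a) (by omega)
        hv h (fun i j _ _ => ?_) (fun i hi => ?_),
      isDoubleStar_farReverse (e := fun a => N + a) (by omega) hv h
        (fun i j _ _ => by omega) (fun i hi => by omega), ?_, Or.inl ?_⟩
    · have := hle i hi
      dsimp only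
      split_ifs <;> omega
    · split_ifs <;> omega
    · split_ifs <;> omega
    · simp only [farReverse]
      split_ifs <;> omega
    · have h1 : farReverse (N - 1) (N - 1) = N - 1 := by unfold farReverse; split_ifs <;> omega
      have h2 : farReverse (N - 1) (N - 2) = 0 := by unfold farReverse; split_ifs <;> omega
      have h3 : farReverse (N - 1) 1 = N - 3 := by unfold farReverse; split_ifs <;> omega
      have h4 : farReverse (N - 1) 0 = N - 2 := by unfold farReverse; split_ifs <;> omega
      simp only [h1, h2, h3, h4]
      simp [show N - 3 < N - 2 by omega, show N + (N - 1) = N + 1 + (N - 2) by omega,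
        show 3 + (N - 3) = N by omega]

/-- The three comparisons between the edges of a triangle `i < j < k`. -/
def triangleType {α : Type*} [LinearOrder α] (H : EdgeOrderedGraph α) (A : Finset α) :
    Prop × Prop × Prop :=
  (∃ i j k, i < j ∧ j < k ∧ A = {i, j, k} ∧ H.lt s(i, j) s(i, k),
    ∃ i j k, i < j ∧ j < k ∧ A = {i, j, k} ∧ H.lt s(i, k) s(j, k),
    ∃ i j k, i < j ∧ j < k ∧ A = {i, j, k} ∧ H.lt s(i, j) s(j, k))

theorem triple_inj {α : Type*} [LinearOrder α] {i j k a b c : α} (hij : i < j) (hjk : j < k)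
    (hab : a < b) (hbc : b < c) (h : ({i, j, k} : Finset α) = {a, b, c}) :
    i = a ∧ j = b ∧ k = c := by
  have key : ∀ {i j k a b c : α}, i < j → j < k → a < b → b < c →
      ({i, j, k} : Finset α) = {a, b, c} → [i, j, k] = [a, b, c] := by
    intro i j k a b c hij hjk hab hbc h
    refine List.Perm.eq_of_pairwise (le := (· < ·)) (fun _ _ _ _ h1 h2 => absurd h1 h2.asymm)
      (by simp [hij, hjk, hij.trans hjk]) (by simp [hab, hbc, hab.trans hbc]) ?_
    rw [List.perm_ext_iff_of_nodup]
    · intro x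
      have := congrArg (x ∈ ·) h
      simpa using this
    · simp [hij.ne, hjk.ne, (hij.trans hjk).ne]
    · simp [hab.ne, hbc.ne, (hab.trans hbc).ne]
  simpa using key hij hjk hab hbc h

theorem triangleType_eq {α : Type*} [LinearOrder α] (H : EdgeOrderedGraph α) {i j k : α}
    (hij : i < j) (hjk : j < k) :
    triangleType H {i, j, k} =
      (H.lt s(i, j) s(i, k), H.lt s(i, k) s(j, k), H.lt s(i, j) s(j, k)) := by
  have key : ∀ P : α → α → α → Prop,
      (∃ a b c, a < b ∧ b < c ∧ ({i, j, k} : Finset α) = {a, b, c} ∧ P a b c) = P i j k := by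
    intro P
    refine propext ⟨?_, fun h => ⟨i, j, k, hij, hjk, rfl, h⟩⟩
    rintro ⟨a, b, c, hab, hbc, h, hP⟩
    obtain ⟨rfl, rfl, rfl⟩ := triple_inj hij hjk hab hbc h
    exact hP
  simp only [triangleType, key fun a b c => H.lt s(a, b) s(a, c),
    key fun a b c => H.lt s(a, c) s(b, c), key fun a b c => H.lt s(a, b) s(b, c)]

/-- A triangle has six possible edge orders. Reversing the list exchanges its first and third
vertices and pairs these orders up, leaving the three treated above. -/
theorem exists_isAbsorbingList_of_homogeneous {v : ℕ → V} {m N : ℕ} (hH : H.graph = ⊤)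
    (hN : 3 ≤ N) (hm : m = 2 * N + 1) (hv : ∀ i j, i < m → j < m → v i = v j → i = j)
    {y : Prop × Prop × Prop} (h : ∀ i j k, i < j → j < k → k < m →
      (H.lt s(v i, v j) s(v i, v k), H.lt s(v i, v k) s(v j, v k),
        H.lt s(v i, v j) s(v j, v k)) = y) :
    ∃ w : ℕ → V, IsAbsorbingList H N m w ∧ w '' Set.Iio m = v '' Set.Iio m := by
  obtain ⟨P, Q, R⟩ := y
  simp only [Prod.mk.injEq] at h
  have flip : ∀ i j k, i < j → j < k → k < m →
      (¬ P → H.lt s(v i, v k) s(v i, v j)) ∧ (¬ Q → H.lt s(v j, v k) s(v i, v k)) ∧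
      (¬ R → H.lt s(v j, v k) s(v i, v j)) := by
    intro i j k hij hjk hk
    obtain ⟨rfl, rfl, rfl⟩ := h i j k hij hjk hk
    have h1 : v i ≠ v j := fun e => by have := hv i j (by omega) (by omega) e; omega
    have h2 : v j ≠ v k := fun e => by have := hv j k (by omega) (by omega) e; omega
    have h3 : v i ≠ v k := fun e => by have := hv i k (by omega) (by omega) e; omega
    refine ⟨(lt_or_lt hH h1 h3 h2).resolve_left, ?_, ?_⟩
    · rw [Sym2.eq_swap (a := v i), Sym2.eq_swap (a := v j)]
      exact (lt_or_lt hH h3.symm h2.symm h1).resolve_left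
    · rw [Sym2.eq_swap (a := v i)]
      exact (lt_or_lt hH h1.symm h2 h3).resolve_left
  have hrev : ∀ i j, i < m → j < m → v (m - 1 - i) = v (m - 1 - j) → i = j := by
    intro i j hi hj hij
    have := hv _ _ (by omega) (by omega) hij
    omega
  have himg : (fun i => v (m - 1 - i)) '' Set.Iio m = v '' Set.Iio m := by
    ext x
    constructor
    · rintro ⟨i, hi, rfl⟩
      exact ⟨m - 1 - i, by simp only [Set.mem_Iio] at hi ⊢; omega, rfl⟩
    · rintro ⟨i, hi, rfl⟩
      simp only [Set.mem_Iio] at hi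
      exact ⟨m - 1 - i, by simp only [Set.mem_Iio]; omega,
        by simp only [show m - 1 - (m - 1 - i) = i by omega]⟩
  by_cases hP : P <;> by_cases hQ : Q <;> by_cases hR : R
  · exact ⟨v, isAbsorbingList_of_increasing hN hm hv fun i j k hij hjk hk =>
      have H := h i j k hij hjk hk; ⟨H.1 ▸ hP, H.2.1 ▸ hQ⟩, rfl⟩
  · exact ⟨v, isAbsorbingList_of_increasing hN hm hv fun i j k hij hjk hk =>
      have H := h i j k hij hjk hk; ⟨H.1 ▸ hP, H.2.1 ▸ hQ⟩, rfl⟩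
  · exact ⟨v, isAbsorbingList_farReverse hN hm hv fun i j k hij hjk hk =>
      ⟨(h i j k hij hjk hk).2.2 ▸ hR, (flip i j k hij hjk hk).2.1 hQ⟩, rfl⟩
  · refine ⟨_, isAbsorbingList_farReverse hN hm hrev fun i j k hij hjk hk => ?_, himg⟩
    have h1 := h (m - 1 - k) (m - 1 - j) (m - 1 - i) (by omega) (by omega) (by omega)
    have h2 := flip (m - 1 - k) (m - 1 - j) (m - 1 - i) (by omega) (by omega) (by omega)
    rw [Sym2.eq_swap, Sym2.eq_swap (b := v (m - 1 - k)), Sym2.eq_swap (b := v (m - 1 - k))]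
    exact ⟨h2.2.2 hR, h1.1 ▸ hP⟩
  · exact ⟨v, isAbsorbingList_nearReverse hN hm hv fun i j k hij hjk hk =>
      ⟨(flip i j k hij hjk hk).1 hP, (h i j k hij hjk hk).2.2 ▸ hR⟩, rfl⟩
  · refine ⟨_, isAbsorbingList_nearReverse hN hm hrev fun i j k hij hjk hk => ?_, himg⟩
    have h1 := h (m - 1 - k) (m - 1 - j) (m - 1 - i) (by omega) (by omega) (by omega)
    have h2 := flip (m - 1 - k) (m - 1 - j) (m - 1 - i) (by omega) (by omega) (by omega)
    rw [Sym2.eq_swap, Sym2.eq_swap (b := v (m - 1 - j)), Sym2.eq_swap (b := v (m - 1 - k))]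
    exact ⟨h1.2.1 ▸ hQ, h2.2.2 hR⟩
  all_goals
    refine ⟨_, isAbsorbingList_of_increasing hN hm hrev fun i j k hij hjk hk => ?_, himg⟩
    have h2 := flip (m - 1 - k) (m - 1 - j) (m - 1 - i) (by omega) (by omega) (by omega)
    rw [Sym2.eq_swap, Sym2.eq_swap (b := v (m - 1 - k)), Sym2.eq_swap (b := v (m - 1 - k))]
    exact ⟨h2.2.1 hQ, h2.1 hP⟩

/-! ### Absorption and tileability of brooms -/

theorem exists_absorbing_number {N : ℕ} (hN : 5 ≤ N) :
    ∃ R, ∀ (α : Type) [LinearOrder α] (H : EdgeOrderedGraph α), H.graph = ⊤ →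
      ∀ W : Finset α, R ≤ W.card → ∃ S ⊆ W, S.card = 2 * N + 1 ∧
        ∀ x ∉ S, IsTiledSet H (broom (N + 1)) (insert x (S : Set α)) := by
  obtain ⟨R, hR⟩ := exists_ramsey_number (κ := Prop × Prop × Prop) 3 (2 * N + 1)
  refine ⟨R, fun α _ H hH W hW => ?_⟩
  obtain ⟨S, hSW, hS, y, hy⟩ := hR α (triangleType H) W hW
  refine ⟨S, hSW, hS, fun x hx => ?_⟩
  let v : ℕ → α := fun i => if hi : i < 2 * N + 1 then S.orderEmbOfFin hS ⟨i, hi⟩ else x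
  have hv : ∀ i (hi : i < 2 * N + 1), v i = S.orderEmbOfFin hS ⟨i, hi⟩ := fun i hi => dif_pos hi
  have hmono : ∀ i j, i < j → j < 2 * N + 1 → v i < v j := fun i j hij hj => by
    rw [hv i (by omega), hv j hj]
    exact (S.orderEmbOfFin hS).strictMono hij
  have hmem : ∀ i, i < 2 * N + 1 → v i ∈ S := fun i hi => by
    rw [hv i hi]; exact S.orderEmbOfFin_mem hS _
  have himg : v '' Set.Iio (2 * N + 1) = S := by
    rw [← S.range_orderEmbOfFin hS]
    ext x
    constructor
    · rintro ⟨i, hi, rfl⟩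
      exact ⟨_, (hv i hi).symm⟩
    · rintro ⟨i, rfl⟩
      exact ⟨i, i.2, hv i i.2⟩
  obtain ⟨w, hw, hwv⟩ := exists_isAbsorbingList_of_homogeneous (N := N) (v := v) hH
    (by omega) rfl
    (fun i j hi hj hij => by
      rcases lt_trichotomy i j with h | h | h
      · exact absurd hij (hmono i j h hj).ne
      · exact h
      · exact absurd hij (hmono j i h hi).ne')
    (y := y) (fun i j k hij hjk hk => by
      have hj : j < 2 * N + 1 := hjk.trans hk
      have h1 := hmono i j hij hj
      have h2 := hmono j k hjk hk
      rw [← triangleType_eq H h1 h2]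
      refine hy _ ?_ ?_
      · intro a ha
        simp only [Finset.mem_insert, Finset.mem_singleton] at ha
        rcases ha with rfl | rfl | rfl
        exacts [hmem _ (hij.trans hj), hmem _ hj, hmem _ hk]
      · rw [Finset.card_eq_three]
        exact ⟨_, _, _, h1.ne, (h1.trans h2).ne, h2.ne, rfl⟩)
  rw [← himg, ← hwv]
  refine hw.isTiledSet_insert hH hN rfl ?_
  rwa [hwv, himg]

/-- Greedily remove `r` disjoint absorbing sets while at least `R` vertices remain. Each set takes
one vertex of `Y`, in any assignment. -/
theorem exists_reservoir {α U : Type*} [DecidableEq α] {H : EdgeOrderedGraph α}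
    {F : EdgeOrderedGraph U} {R m : ℕ}
    (h : ∀ W : Finset α, R ≤ W.card → ∃ S ⊆ W, S.card = m ∧
      ∀ x ∉ S, IsTiledSet H F (insert x (S : Set α)))
    (r : ℕ) (W : Finset α) (hW : W.card = R + r * m) :
    ∃ X ⊆ W, X.card = R ∧ ∀ Y ⊆ X, Y.card = r →
      IsTiledSet H F ((W \ X ∪ Y : Finset α) : Set α) := by
  induction r generalizing W with
  | zero =>
    refine ⟨W, subset_rfl, by simpa using hW, fun Y _ hY => ?_⟩
    rw [Finset.card_eq_zero.mp hY]
    simpa using isTiledSet_empty F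
  | succ r ih =>
    obtain ⟨S, hSW, hSm, hS⟩ := h W (by omega)
    obtain ⟨X, hX, hXR, hXY⟩ := ih (W \ S) (by
      rw [Finset.card_sdiff_of_subset hSW, hSm, hW, Nat.succ_mul]; omega)
    refine ⟨X, hX.trans Finset.sdiff_subset, hXR, fun Y hY hYr => ?_⟩
    obtain ⟨y, hy⟩ := Finset.card_pos.mp (show 0 < Y.card by omega)
    have hyS : y ∉ S := (Finset.mem_sdiff.mp (hX (hY hy))).2
    have h1 := (hS y hyS).union (hXY (Y.erase y) ((Finset.erase_subset _ _).trans hY)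
      (by rw [Finset.card_erase_of_mem hy]; omega)) ?_
    · convert h1 using 1
      rw [← Finset.coe_insert, ← Finset.coe_union]
      congr 1
      ext a
      have ha1 : a ∈ S → a ∈ W := fun h => hSW h
      have ha2 : a ∈ X → a ∉ S := fun h => (Finset.mem_sdiff.mp (hX h)).2
      simp only [Finset.mem_union, Finset.mem_sdiff, Finset.mem_insert, Finset.mem_erase]
      by_cases hay : a = y
      · subst hay; simp [hy]
      · simp only [hay, false_or, ne_eq, not_false_eq_true, true_and]
        tauto
    · rw [← Finset.coe_insert, Finset.disjoint_coe, Finset.disjoint_left]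
      intro a ha ha'
      simp only [Finset.mem_union, Finset.mem_sdiff, Finset.mem_insert, Finset.mem_erase] at ha ha'
      rcases ha with rfl | ha
      · rcases ha' with ha' | ha'
        · exact ha'.2 (hY hy)
        · exact ha'.1 rfl
      · rcases ha' with ha' | ha'
        · exact ha'.1.2 ha
        · exact (Finset.mem_sdiff.mp (hX (hY ha'.2))).2 ha

theorem tileable_broom {n : ℕ} (hn : 6 ≤ n) : (broom n).Tileable := by
  obtain ⟨N, rfl⟩ : ∃ N, n = N + 1 := ⟨n - 1, by omega⟩
  obtain ⟨R, hR⟩ := exists_absorbing_number (N := N) (by omega)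
  -- With `R + 1` absorbing sets of size 2N + 1 and a reservoir of `R + 1` vertices, `Y` can be the
  -- whole reservoir. Using `R + 1` instead of `R` keeps the total positive.
  refine ⟨(R + 1) * (2 * (N + 1)), by positivity, ?_, fun H hH => ?_⟩
  · rw [Fintype.card_fin]
    exact ⟨2 * (R + 1), by ring⟩
  · obtain ⟨X, -, hX, hXY⟩ := exists_reservoir (R := R + 1)
      (fun W hW => hR _ H hH W (Nat.le_of_succ_le hW)) (R + 1) Finset.univ
      (by rw [Finset.card_univ, Fintype.card_fin]; ring)
    have := hXY X subset_rfl hX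
    rw [Finset.sdiff_union_of_subset (Finset.subset_univ _), Finset.coe_univ] at this
    exact this

end EdgeOrderedGraph

namespace EdgeOrderedGraph

/-! ### Brooms as iterated pendant extensions of `D4` -/

theorem ext_of_lt {V : Type*} {F F' : EdgeOrderedGraph V} (hg : F.graph = F'.graph)
    (hlt : ∀ e e', F.lt e e' ↔ F'.lt e e') : F = F' := by
  obtain ⟨g, l, _⟩ := F
  obtain ⟨g', l', _⟩ := F'
  obtain rfl : g = g' := hg
  obtain rfl : l = l' := by
    funext e e'
    exact propext (hlt e e')
  rfl

theorem broomEdge_iff_D4 (a b : Fin 4) :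
    BroomEdge a b ∨ BroomEdge b a ↔ D4.graph.Adj a b := by
  have h : D4.graph.Adj a b ↔ s(a, b) ∈ edgesD4 ∧ a ≠ b := by
    simp [D4, ofLabeling]
  rw [h]
  clear h
  unfold BroomEdge edgesD4
  revert a b
  decide

theorem broom_four : broom 4 = D4 := by
  have hg : (broom 4).graph = D4.graph := by
    ext a b
    exact broomEdge_iff_D4 a b
  refine ext_of_lt hg fun e e' => ?_
  have key : ∀ a b c d : Fin 4, BroomEdge a b → BroomEdge c d →
      (broomWeight a b < broomWeight c d ↔ edgesD4.idxOf s(a, b) < edgesD4.idxOf s(c, d)) := by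
    unfold BroomEdge edgesD4
    decide
  constructor
  · intro h
    obtain ⟨a, b, c, d, rfl, rfl, hab, hcd, hw⟩ := exists_of_broom_lt h
    refine ⟨?_, ?_, (key a b c d hab hcd).mp hw⟩
    · change _ ∈ D4.graph.edgeSet
      exact hg ▸ mem_edgeSet_broom hab
    · change _ ∈ D4.graph.edgeSet
      exact hg ▸ mem_edgeSet_broom hcd
  · rintro ⟨he, he', hlt⟩
    obtain ⟨a, b, rfl, hab⟩ := exists_broomEdge (n := 4) (hg.symm ▸ he : e ∈ (broom 4).graph.edgeSet)
    obtain ⟨c, d, rfl, hcd⟩ := exists_broomEdge (n := 4) (hg.symm ▸ he' : e' ∈ (broom 4).graph.edgeSet)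
    exact (broom_lt_iff hab hcd).mpr ((key a b c d hab hcd).mpr hlt)

theorem minOrdering_lt {n : ℕ} {a b c d : Fin n} (hab : a < b) (hcd : c < d)
    (h : a < c ∨ a = c ∧ b < d) : (minOrdering n).lt s(a, b) s(c, d) := by
  refine ⟨hab.ne, hcd.ne, ?_⟩
  simpa [Prod.Lex.toLex_lt_toLex, hab.le, hcd.le] using h

theorem maxOrdering_lt {n : ℕ} {a b c d : Fin n} (hab : a < b) (hcd : c < d)
    (h : b < d ∨ b = d ∧ a < c) : (maxOrdering n).lt s(a, b) s(c, d) := by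
  refine ⟨hab.ne, hcd.ne, ?_⟩
  simpa [Prod.Lex.toLex_lt_toLex, hab.le, hcd.le] using h

/-- Common to the min and max orderings: in both, the vertices in their natural order form a double
star whose centres are the first and the last vertex. -/
theorem exists_isEmbedding_of_increasing {n : ℕ} (hn : 4 ≤ n) {H : EdgeOrderedGraph (Fin n)}
    (hH : H.graph = ⊤)
    (h : ∀ i j k : Fin n, i < j → j < k → H.lt s(i, j) s(i, k) ∧ H.lt s(i, k) s(j, k)) :
    ∃ φ : Fin n → Fin n, IsEmbedding (broom n) H φ ∧ φ ⟨0, by omega⟩ = ⟨0, by omega⟩ ∧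
      φ ⟨3, by omega⟩ = ⟨n - 1, by omega⟩ := by
  -- Truncation at `n - 1` only makes `v` total on ℕ.
  let v : ℕ → Fin n := fun i => ⟨min i (n - 1), by omega⟩
  have hv : ∀ i j, i < j → j < n → v i < v j := fun i j hij hj => by
    simp only [v, Fin.mk_lt_mk]; omega
  have hds : IsDoubleStar H (n - 1) v := isDoubleStar_of_increasing (m := n) (e := fun i => i)
    (fun i j hi hj hij => by simp only [Fin.mk.injEq] at hij; omega)
    (fun i j k hij hjk hk => h _ _ _ (hv i j hij (by omega)) (hv j k hjk hk))
    (fun i j hij _ => hij) (fun i hi => by omega)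
  obtain ⟨φ, hφ, -, h0, h3⟩ := (hds.isBroomList (k := (n - 3) / 2) (by omega)).exists_isEmbedding
    hH hn rfl (by omega)
  exact ⟨φ, hφ, by simp [h0, v], by simp [h3, v]⟩

theorem isMinimalVertex_broom {n : ℕ} (hn : 4 ≤ n) :
    (broom n).IsMinimalVertex ⟨0, by omega⟩ := by
  obtain ⟨φ, hφ, h0, -⟩ := exists_isEmbedding_of_increasing hn (H := minOrdering n) rfl
    fun i j k hij hjk => ⟨minOrdering_lt hij (hij.trans hjk) (Or.inr ⟨rfl, hjk⟩),
      minOrdering_lt (hij.trans hjk) hjk (Or.inl hij)⟩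
  exact ⟨φ, hφ, by rw [h0]⟩

theorem isMaximalVertex_broom {n : ℕ} (hn : 4 ≤ n) :
    (broom n).IsMaximalVertex ⟨3, by omega⟩ := by
  obtain ⟨φ, hφ, -, h3⟩ := exists_isEmbedding_of_increasing hn (H := maxOrdering n) rfl
    fun i j k hij hjk => ⟨maxOrdering_lt hij (hij.trans hjk) (Or.inl hjk),
      maxOrdering_lt (hij.trans hjk) hjk (Or.inr ⟨rfl, hij⟩)⟩
  exact ⟨φ, hφ, by rw [h3]; simp only; omega⟩

theorem isPendantExtension_broom {n : ℕ} {v : Fin n}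
    (hv : ∀ x : ℕ, x < n → (BroomEdge x n ↔ x = v)) :
    IsPendantExtension (broom n) v (broom (n + 1)) Fin.castSucc (Fin.last n) where
  injective := Fin.castSucc_injective n
  range_eq := by
    ext x
    simp [Fin.range_castSucc, Fin.ext_iff]
    omega
  adj_iff _ _ := Iff.rfl
  adj_new_iff x := by
    have h1 : ¬ BroomEdge n x := fun h => absurd h.lt (by omega)
    have h2 := hv x x.2
    change BroomEdge n x ∨ BroomEdge x n ↔ _
    rw [h2, Fin.ext_iff]
    simp [h1]
  lt_iff e e' := by
    constructor
    · intro h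
      have he : ∀ e, e.map Fin.castSucc ∈ (broomGraph (n + 1)).edgeSet →
          e ∈ (broomGraph n).edgeSet := by
        intro e
        induction e using Sym2.ind with
        | _ a b => exact id
      obtain ⟨a, b, rfl, hab⟩ := exists_broomEdge (he e h.1)
      obtain ⟨c, d, rfl, hcd⟩ := exists_broomEdge (he e' h.2.1)
      exact (broom_lt_iff hab hcd).mpr
        ((broom_lt_iff (n := n + 1) (a := a.castSucc) (b := b.castSucc) (c := c.castSucc)
          (d := d.castSucc) hab hcd).mp h)
    · intro h
      obtain ⟨a, b, c, d, rfl, rfl, hab, hcd, hw⟩ := exists_of_broom_lt h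
      exact (broom_lt_iff (n := n + 1) (a := a.castSucc) (b := b.castSucc) (c := c.castSucc)
          (d := d.castSucc) hab hcd).mpr hw

theorem addsSmallestPendant_broom {n : ℕ} (hn : 4 ≤ n) (he : Even n) :
    (broom n).AddsSmallestPendant ⟨0, by omega⟩ (broom (n + 1)) := by
  have he2 := Nat.even_iff.mp he
  refine ⟨Fin.castSucc, Fin.last n, isPendantExtension_broom fun x hx => ?_, fun e h => ?_⟩
  · unfold BroomEdge
    simp only
    omega
  · obtain ⟨a, b, rfl, hab⟩ := exists_broomEdge h
    rw [Sym2.eq_swap, Sym2.map_mk]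
    have h0 : BroomEdge ((⟨0, by omega⟩ : Fin n).castSucc : ℕ) (Fin.last n : ℕ) := by
      change BroomEdge 0 n
      unfold BroomEdge
      omega
    refine (broom_lt_iff (n := n + 1) h0 hab).mpr ?_
    change broomWeight 0 n < broomWeight a b
    have := b.2
    unfold broomWeight
    split_ifs <;> omega

theorem addsLargestPendant_broom {n : ℕ} (hn : 4 ≤ n) (ho : Odd n) :
    (broom n).AddsLargestPendant ⟨3, by omega⟩ (broom (n + 1)) := by
  have ho2 := Nat.odd_iff.mp ho
  refine ⟨Fin.castSucc, Fin.last n, isPendantExtension_broom fun x hx => ?_, fun e h => ?_⟩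
  · unfold BroomEdge
    simp only
    omega
  · obtain ⟨a, b, rfl, hab⟩ := exists_broomEdge h
    rw [Sym2.eq_swap (b := Fin.castSucc _), Sym2.map_mk]
    have h0 : BroomEdge ((⟨3, by omega⟩ : Fin n).castSucc : ℕ) (Fin.last n : ℕ) := by
      change BroomEdge 3 n
      unfold BroomEdge
      omega
    refine (broom_lt_iff (n := n + 1) hab h0).mpr ?_
    have := b.2
    have := a.2
    unfold BroomEdge at hab
    change broomWeight a b < broomWeight 3 n
    unfold broomWeight
    split_ifs <;> first | contradiction | omega

theorem connected_broom {n : ℕ} (hn : 4 ≤ n) : (broom n).graph.Connected := by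
  have key : ∀ a : Fin n, (broom n).graph.Reachable ⟨0, by omega⟩ a := by
    intro a
    have h03 : (broom n).graph.Adj ⟨0, by omega⟩ ⟨3, by omega⟩ := Or.inl (by simp [BroomEdge])
    rcases Nat.eq_zero_or_pos (a : ℕ) with h0 | h0
    · rw [show a = ⟨0, by omega⟩ from Fin.ext h0]
    · by_cases h : (a : ℕ) ≤ 3 ∨ (a : ℕ) % 2 = 0
      · exact SimpleGraph.Adj.reachable (Or.inl (Or.inl ⟨rfl, h0, h⟩))
      · refine h03.reachable.trans (SimpleGraph.Adj.reachable (Or.inl (Or.inr (Or.inr ⟨rfl, ?_⟩))))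
        omega
  have : Nonempty (Fin n) := ⟨⟨0, by omega⟩⟩
  exact ⟨fun a b => (key a).symm.trans (key b)⟩

theorem containsCopy_D4_broom {n : ℕ} (hn : 4 ≤ n) : (broom n).ContainsCopy D4 := by
  rw [← broom_four]
  refine ⟨Fin.castLE hn, Fin.castLE_injective hn, fun _ _ h => h, fun e e' h => ?_⟩
  obtain ⟨a, b, c, d, rfl, rfl, hab, hcd, hw⟩ := exists_of_broom_lt h
  exact (broom_lt_iff (a := a.castLE hn) (b := b.castLE hn) (c := c.castLE hn)
    (d := d.castLE hn) hab hcd).mpr hw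

theorem K4Minus_isContained_broom {n : ℕ} (hn : 4 ≤ n) :
    SimpleGraph.IsContained K4Minus (broom n).graph := by
  refine ⟨⟨⟨Fin.castLE hn, fun {a b} h => ?_⟩, Fin.castLE_injective hn⟩⟩
  have h' : a ≠ b ∧ ¬ s(a, b) = s(1, 2) := by simpa [K4Minus] using h
  have key : ∀ a b : Fin 4, a ≠ b ∧ ¬ s(a, b) = s(1, 2) → BroomEdge a b ∨ BroomEdge b a := by
    unfold BroomEdge
    decide
  exact key a b h'

/-! ### `D4` is not tileable -/

/-- The min ordering with the order of the edges at the first vertex reversed. -/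
def reversedFirst (n : ℕ) : EdgeOrderedGraph (Fin n) :=
  ofLabeling (⊤ : SimpleGraph (Fin n))
    (fun e => toLex ((e.inf : ℕ), if (e.inf : ℕ) = 0 then -(e.sup : ℤ) else (e.sup : ℤ))) (by
    intro e _ e' _ h
    have h' := Prod.mk.inj (toLex.injective h)
    refine Sym2.inf_eq_inf_and_sup_eq_sup.mp ⟨Fin.ext h'.1, Fin.ext ?_⟩
    have h2 := h'.2
    rw [h'.1] at h2
    split_ifs at h2 <;> omega)

theorem reversedFirst_lt_zero {n : ℕ} {x a b : Fin n} (hx : (x : ℕ) = 0)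
    (h : (reversedFirst n).lt s(x, a) s(x, b)) : b < a := by
  have h' := h.2.2
  have hxa : x ≤ a := Fin.le_def.mpr (by omega)
  have hxb : x ≤ b := Fin.le_def.mpr (by omega)
  simpa [Prod.Lex.toLex_lt_toLex, hxa, hxb, hx] using h'

theorem reversedFirst_not_lt_zero {n : ℕ} {x a b c : Fin n} (hx : (x : ℕ) = 0)
    (hb : b ≠ x) (hc : c ≠ x) : ¬ (reversedFirst n).lt s(b, c) s(x, a) := by
  intro h
  have h' := h.2.2
  have hxa : x ≤ a := Fin.le_def.mpr (by omega)
  have hb0 : (b : ℕ) ≠ 0 := fun h0 => hb (Fin.ext (h0.trans hx.symm))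
  have hc0 : (c : ℕ) ≠ 0 := fun h0 => hc (Fin.ext (h0.trans hx.symm))
  have hmin : ((b ⊓ c : Fin n) : ℕ) ≠ 0 := by
    rcases le_total b c with hbc | hbc <;> simpa [hbc]
  simp [Prod.Lex.toLex_lt_toLex, hxa, hx] at h'
  omega

theorem reversedFirst_lt_pos {n : ℕ} {a b c : Fin n} (ha : (a : ℕ) ≠ 0) (hab : b < c)
    (hac : a < b) : ¬ (reversedFirst n).lt s(a, c) s(a, b) := by
  intro h
  have h' := h.2.2
  have := hac.trans hab
  simp [Prod.Lex.toLex_lt_toLex, hac.le, this.le, ha] at h'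
  omega

theorem D4_lt_of_idxOf {e e' : Sym2 (Fin 4)} (he : e ∈ edgesD4 ∧ ¬ e.IsDiag)
    (he' : e' ∈ edgesD4 ∧ ¬ e'.IsDiag) (h : edgesD4.idxOf e < edgesD4.idxOf e') :
    D4.lt e e' := by
  refine ⟨?_, ?_, h⟩ <;> rw [SimpleGraph.edgeSet_fromEdgeSet]
  · exact he
  · exact he'

/-- All edges at the first vertex precede all others, whereas each of `1`, `2`, `3` lies on an edge
of `D4` that comes after an edge avoiding it. Only `0` could thus be sent there. The reversal then
forces `φ 3 < φ 2 < φ 1`, so the edges from `φ 3` to `φ 1` and `φ 2` come in the wrong order. -/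
theorem IsEmbedding.val_ne_zero_of_reversedFirst {n : ℕ} {φ : Fin 4 → Fin n}
    (hφ : IsEmbedding D4 (reversedFirst n) φ) (u : Fin 4) : (φ u : ℕ) ≠ 0 := by
  intro hu
  have h12 : (reversedFirst n).lt s(φ 0, φ 1) s(φ 0, φ 2) :=
    hφ.map_lt s(0, 1) s(0, 2) (D4_lt_of_idxOf (by decide) (by decide) (by decide))
  have h23 : (reversedFirst n).lt s(φ 0, φ 2) s(φ 0, φ 3) :=
    hφ.map_lt s(0, 2) s(0, 3) (D4_lt_of_idxOf (by decide) (by decide) (by decide))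
  have h34 : (reversedFirst n).lt s(φ 0, φ 3) s(φ 1, φ 3) :=
    hφ.map_lt s(0, 3) s(1, 3) (D4_lt_of_idxOf (by decide) (by decide) (by decide))
  have h45 : (reversedFirst n).lt s(φ 1, φ 3) s(φ 2, φ 3) :=
    hφ.map_lt s(1, 3) s(2, 3) (D4_lt_of_idxOf (by decide) (by decide) (by decide))
  have hne : ∀ a b : Fin 4, a ≠ b → φ a ≠ φ b := fun a b hab h => hab (hφ.injective h)
  fin_cases u
  · have h1 := reversedFirst_lt_zero hu h12
    have h2 := reversedFirst_lt_zero hu h23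
    rw [Sym2.eq_swap, Sym2.eq_swap (a := φ 2)] at h45
    refine reversedFirst_lt_pos ?_ h1 h2 h45
    intro h3
    exact hne 3 0 (by decide) (Fin.ext (h3.trans hu.symm))
  · exact reversedFirst_not_lt_zero hu (hne 0 1 (by decide)) (hne 3 1 (by decide)) h34
  · exact reversedFirst_not_lt_zero hu (hne 1 2 (by decide)) (hne 3 2 (by decide)) h45
  · rw [Sym2.eq_swap (b := φ 3)] at h23
    exact reversedFirst_not_lt_zero hu (hne 0 3 (by decide)) (hne 2 3 (by decide)) h23

theorem not_tileable_D4 : ¬ D4.Tileable := by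
  rintro ⟨t, ht, -, h⟩
  obtain ⟨T, hT, -, hcov⟩ := h (reversedFirst t) rfl
  have h0 : (⟨0, ht⟩ : Fin t) ∈ ⋃ φ ∈ T, Set.range φ := hcov ▸ Set.mem_univ _
  simp only [Set.mem_iUnion, Set.mem_range] at h0
  obtain ⟨φ, hφ, u, hu⟩ := h0
  exact (hT φ hφ).val_ne_zero_of_reversedFirst u (by rw [hu])

end EdgeOrderedGraph

theorem corollary2p16 :
    -- the graphs `F n`, `n ≥ 6`, are built from `D₄` by successively adding pendant edges,
    -- alternately a smallest one at a minimal vertex and a largest one at a maximal vertex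
    (∃ F : (n : ℕ) → EdgeOrderedGraph (Fin n),
      F 4 = EdgeOrderedGraph.D4 ∧
      (∀ n : ℕ, 4 ≤ n → Even n →
        ∃ v : Fin n, (F n).IsMinimalVertex v ∧ (F n).AddsSmallestPendant v (F (n + 1))) ∧
      (∀ n : ℕ, 4 ≤ n → Odd n →
        ∃ v : Fin n, (F n).IsMaximalVertex v ∧ (F n).AddsLargestPendant v (F (n + 1))) ∧
      ∀ n : ℕ, 6 ≤ n →
        (F n).graph.Connected ∧ (F n).Tileable ∧
        SimpleGraph.IsContained K4Minus (F n).graph ∧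
        (F n).ContainsCopy EdgeOrderedGraph.D4) ∧
    -- the connected edge-ordered graph `D₄` itself is not tileable
    (EdgeOrderedGraph.D4.graph.Connected ∧ ¬ EdgeOrderedGraph.D4.Tileable) ∧
    -- hence tileability is not closed under taking connected subgraphs
    ¬ (∀ (m n : ℕ) (A : EdgeOrderedGraph (Fin m)) (B : EdgeOrderedGraph (Fin n)),
        B.graph.Connected → B.Tileable → B.ContainsCopy A → A.graph.Connected →
        A.Tileable) := by
  have hD4 : EdgeOrderedGraph.D4.graph.Connected :=
    EdgeOrderedGraph.broom_four ▸ EdgeOrderedGraph.connected_broom le_rfl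
  refine ⟨⟨EdgeOrderedGraph.broom, EdgeOrderedGraph.broom_four, fun n hn he => ?_, fun n hn ho => ?_,
    fun n hn => ?_⟩, ⟨hD4, EdgeOrderedGraph.not_tileable_D4⟩, fun h => ?_⟩
  · exact ⟨_, EdgeOrderedGraph.isMinimalVertex_broom hn,
      EdgeOrderedGraph.addsSmallestPendant_broom hn he⟩
  · exact ⟨_, EdgeOrderedGraph.isMaximalVertex_broom hn,
      EdgeOrderedGraph.addsLargestPendant_broom hn ho⟩
  · have hn4 : 4 ≤ n := by omega
    exact ⟨EdgeOrderedGraph.connected_broom hn4, EdgeOrderedGraph.tileable_broom hn,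
      EdgeOrderedGraph.K4Minus_isContained_broom hn4, EdgeOrderedGraph.containsCopy_D4_broom hn4⟩
  · exact EdgeOrderedGraph.not_tileable_D4 (h 4 6 _ _
      (EdgeOrderedGraph.connected_broom (by norm_num)) (EdgeOrderedGraph.tileable_broom le_rfl)
      (EdgeOrderedGraph.containsCopy_D4_broom (by norm_num)) hD4)
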